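/- **Theorem.** The first-order theories $\mathsf{ID}$ and $\mathsf{ID}^{*}$ are mutually interpretable. Here, for a nonempty binary string $\alpha$, the biteral $\overline{\alpha}$ is the closed term over the constants $0,1$ and the binary function symbol $\circ$ (written as juxtaposition) given by $\overline{\boldsymbol 0}=0$, $\overline{\boldsymbol 1}=1$, $\overline{\alpha\boldsymbol 0}=(\overline{\alpha}\,0)$, $\overline{\alpha\boldsymbol 1}=(\overline{\alpha}\,1)$; $\mathsf{Pref}(\alpha)$ and $\mathsf{Sub}(\alpha)$ are the sets of nonempty prefixes and of nonempty (contiguous) substrings of $\alpha$; and $x\sqsubseteq_{\mathsf s}y$ abbreviates $x=y\vee\exists u v\,[\,y=ux\vee y=xv\vee y=uxv\,]$. The theory $\mathsf{ID}$, in the language $\{0,1,\circ,\preceq\}$ with $\preceq$ a binary relation symbol, has the non-logical axioms - $\mathsf{ID}_1$: $\forall xyz\,[(xy)z=x(yz)]$; - $\mathsf{ID}_2$: $\forall xy\,[x\neq y\to(x0\neq y0\wedge x1\neq y1)]$; - $\mathsf{ID}_3$: $\forall xy\,[x0\neq y1]$; - $\mathsf{ID}_4$: $\forall x\,[x\preceq\overline{\alpha}\leftrightarrow\bigvee_{\gamma\in\mathsf{Pref}(\alpha)}x=\overline{\gamma}]$,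 for each nonempty binary string $\alpha$. The theory $\mathsf{ID}^{*}$ has the axioms $\mathsf{ID}_1,\mathsf{ID}_2,\mathsf{ID}_3$ and - $\mathsf{ID}_4^{*}$: $\forall x\,[x\sqsubseteq_{\mathsf s}\overline{\alpha}\to\bigvee_{\gamma\in\mathsf{Sub}(\alpha)}x=\overline{\gamma}]$, for each nonempty binary string $\alpha$. The statement holds both when the language of $\mathsf{ID}^{*}$ is $\{0,1,\circ\}$ and when it is $\{0,1,\circ,\preceq\}$. Interpretability is many-dimensional, parameter-free, one-piece relative interpretability. A translation $\tau$ from a language $\mathcal L_1$ to a language $\mathcal L_2$ consists of a dimension $m\ge 1$, a domain formula $\delta(x_1,\dots,x_m)$, and a formula $\psi_R$, $\psi_f$ for every relation symbol (including equality) and every function or constant symbol of $\mathcal L_1$; variables become $m$-tuples, terms are translated through the graphs $\psi_f$, quantifiers are relativized to $\delta$, and $\tau$ commutes with the connectives. An $\mathcal L_1$-theory $S$ is interpretable in an $\mathcal L_2$-theory $T$ if for some such $\tau$ the theory $T$ proves $\exists\vec x\,\delta(\vec x)$, proves $\bigwedge_i\delta(\vec x_i)\to\exists!\vec y\,[\delta(\vec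 y)\wedge\psi_f(\vec x_1,\dots,\vec x_n,\vec y)]$ for all function and constant symbols $f$ of $\mathcal L_1$, and proves the translations of the equality axioms and of all non-logical axioms of $S$. $S$ and $T$ are mutually interpretable if each is interpretable in the other. -/

import Mathlib

open FirstOrder FirstOrder.Language

/-! ### Relative translations and interpretations

Provability `T ⊢ φ` of first-order logic with equality is Mathlib's consequence relation `T ⊨ᵇ φ`
(the universal closure of `φ` holds in all nonempty models of `T`). -/

/-- A many-dimensional, parameter-free, one-piece relative translation from `L₁` to `L₂`.
Variables are replaced by `dim`-tuples of variables. Equality is treated as a binary relation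
symbol, and constant symbols are the function symbols of arity `0`. -/
structure RelTranslation (L₁ L₂ : FirstOrder.Language.{0, 0}) where
  /-- the length of the tuples -/
  dim : ℕ
  dim_pos : 0 < dim
  /-- the domain formula `δ` -/
  dom : L₂.Formula (Fin dim)
  /-- the formula that translates equality -/
  eq : L₂.Formula (Fin 2 × Fin dim)
  /-- the formulas `ψ_R`; the variable `(j, i)` is the `i`-th entry of the `j`-th tuple -/
  rel : ∀ {n : ℕ}, L₁.Relations n → L₂.Formula (Fin n × Fin dim)
  /-- the formulas `ψ_f`; the variables `Sum.inr i` form the tuple of the value -/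
  fn : ∀ {n : ℕ}, L₁.Functions n → L₂.Formula ((Fin n × Fin dim) ⊕ Fin dim)

namespace RelTranslation

variable {L₁ L₂ : FirstOrder.Language.{0, 0}}

/-- The formula `(t)^{τ, w}` saying that the tuple `w` (the variables `Sum.inr i`) is the value of
the term `t`; the variable `x` of `t` becomes the tuple of the variables `Sum.inl (x, i)`. -/
noncomputable def term (τ : RelTranslation L₁ L₂) {α : Type} :
    L₁.Term α → L₂.Formula ((α × Fin τ.dim) ⊕ Fin τ.dim)
  | .var x => Formula.iInf fun i : Fin τ.dim =>
      Term.equal (Term.var (Sum.inr i)) (Term.var (Sum.inl (x, i)))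
  | @Term.func _ _ n f ts => Formula.iExs (Fin n × Fin τ.dim)
      ((Formula.iInf fun j : Fin n => τ.dom.relabel fun i => Sum.inr (j, i)) ⊓
        (Formula.iInf fun j : Fin n => (τ.term (ts j)).relabel
          (Sum.elim (fun p => Sum.inl (Sum.inl p)) (fun i => Sum.inr (j, i)))) ⊓
        (τ.fn f).relabel (Sum.elim (fun p => Sum.inr p) (fun i => Sum.inl (Sum.inr i))))

/-- The translation `∃ v₁ … vₙ [⋀ δ(vⱼ) ∧ ⋀ (tⱼ)^{τ, vⱼ} ∧ ψ(v₁, …, vₙ)]` of an atomic formula. -/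
noncomputable def atomic (τ : RelTranslation L₁ L₂) {α : Type} {n : ℕ}
    (ψ : L₂.Formula (Fin n × Fin τ.dim)) (ts : Fin n → L₁.Term α) :
    L₂.Formula (α × Fin τ.dim) :=
  Formula.iExs (Fin n × Fin τ.dim)
    ((Formula.iInf fun j : Fin n => τ.dom.relabel fun i => Sum.inr (j, i)) ⊓
      (Formula.iInf fun j : Fin n => (τ.term (ts j)).relabel
        (Sum.elim Sum.inl (fun i => Sum.inr (j, i)))) ⊓
      ψ.relabel Sum.inr)

/-- Renaming of variables that separates the tuple of the last bound variable from the others. -/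
def splitLast {α : Type} {n m : ℕ} :
    (α ⊕ Fin (n + 1)) × Fin m → ((α ⊕ Fin n) × Fin m) ⊕ Fin m
  | (Sum.inl a, i) => Sum.inl (Sum.inl a, i)
  | (Sum.inr k, i) =>
      Fin.lastCases (motive := fun _ => ((α ⊕ Fin n) × Fin m) ⊕ Fin m)
        (Sum.inr i) (fun k' => Sum.inl (Sum.inr k', i)) k

/-- The translation `φ^τ` of formulas. It commutes with `⊥` and `→`, and
`(∀ x φ)^τ` is `∀ x⃗ [δ(x⃗) → φ^τ]`; the other connectives and `∃` are defined from these. -/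
noncomputable def formula (τ : RelTranslation L₁ L₂) {α : Type} :
    {n : ℕ} → L₁.BoundedFormula α n → L₂.Formula ((α ⊕ Fin n) × Fin τ.dim)
  | _, .falsum => ⊥
  | _, .equal t₁ t₂ => τ.atomic τ.eq ![t₁, t₂]
  | _, .rel R ts => τ.atomic (τ.rel R) ts
  | _, .imp φ ψ => (τ.formula φ).imp (τ.formula ψ)
  | _, .all φ => Formula.iAlls (Fin τ.dim)
      ((τ.dom.relabel Sum.inr).imp ((τ.formula φ).relabel splitLast))

end RelTranslation

/-- The equality axioms of the language `L`: reflexivity, symmetry, transitivity, and congruence for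
all function symbols and all relation symbols. -/
inductive EqualityAxiom (L : FirstOrder.Language.{0, 0}) : L.Sentence → Prop
  | refl : EqualityAxiom L (∀' (&0 =' &0))
  | symm : EqualityAxiom L (∀' ∀' ((&0 =' &1) ⟹ (&1 =' &0)))
  | trans : EqualityAxiom L (∀' ∀' ∀' ((&0 =' &1) ⟹ ((&1 =' &2) ⟹ (&0 =' &2))))
  | congrFn {n : ℕ} (f : L.Functions n) : EqualityAxiom L
      (Formula.iAlls (Fin n ⊕ Fin n)
        ((Formula.iInf fun j : Fin n => Term.equal
          (Term.var (Sum.inr (Sum.inl j))) (Term.var (Sum.inr (Sum.inr j)))).imp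
        (Term.equal (Term.func f fun j => Term.var (Sum.inr (Sum.inl j)))
          (Term.func f fun j => Term.var (Sum.inr (Sum.inr j))))))
  | congrRel {n : ℕ} (R : L.Relations n) : EqualityAxiom L
      (Formula.iAlls (Fin n ⊕ Fin n)
        ((Formula.iInf fun j : Fin n => Term.equal
          (Term.var (Sum.inr (Sum.inl j))) (Term.var (Sum.inr (Sum.inr j)))).imp
        ((R.formula fun j => Term.var (Sum.inr (Sum.inl j))).imp
          (R.formula fun j => Term.var (Sum.inr (Sum.inr j))))))

/-- The translation `τ` is an interpretation of the theory `S` in the theory `T`. -/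
structure RelTranslation.IsInterpretation {L₁ L₂ : FirstOrder.Language.{0, 0}}
    (τ : RelTranslation L₁ L₂) (S : L₁.Theory) (T : L₂.Theory) : Prop where
  /-- `T ⊢ ∃ x⃗ δ(x⃗)` -/
  dom_nonempty : T ⊨ᵇ (Formula.iExs (Fin τ.dim) (τ.dom.relabel Sum.inr) : L₂.Sentence)
  /-- `T ⊢ ⋀ δ(x⃗ⱼ) → ∃! y⃗ [δ(y⃗) ∧ ψ_f(x⃗₁, …, x⃗ₙ, y⃗)]`, for constants as well -/
  fn_total : ∀ {n : ℕ} (f : L₁.Functions n),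
    T ⊨ᵇ ((Formula.iInf fun j : Fin n => τ.dom.relabel fun i => (j, i)).imp
      (Formula.iExsUnique (Fin τ.dim) (τ.dom.relabel Sum.inr ⊓ τ.fn f)) :
        L₂.Formula (Fin n × Fin τ.dim))
  /-- `T` proves the translation of the equality axioms; this is automatic if equality is
  translated as equality. -/
  eq_axioms : ∀ φ : L₁.Sentence, EqualityAxiom L₁ φ → T ⊨ᵇ τ.formula φ
  /-- `T` proves the translation of the non-logical axioms of `S`. -/
  axioms : ∀ φ ∈ S, T ⊨ᵇ τ.formula φ

/-- `S` is relatively interpretable in `T`. -/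
def Interpretable {L₁ L₂ : FirstOrder.Language.{0, 0}} (S : L₁.Theory) (T : L₂.Theory) : Prop :=
  ∃ τ : RelTranslation L₁ L₂, τ.IsInterpretation S T

/-- `S` and `T` are mutually interpretable. -/
def MutuallyInterpretable {L₁ L₂ : FirstOrder.Language.{0, 0}}
    (S : L₁.Theory) (T : L₂.Theory) : Prop :=
  Interpretable S T ∧ Interpretable T S

/-! ### Theories of concatenation -/

/-- The function symbols: the constants `0`, `1` and the binary concatenation symbol. -/
inductive ConcatFn : ℕ → Type
  | zero : ConcatFn 0
  | one : ConcatFn 0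
  | conc : ConcatFn 2

/-- The only relation symbol: the binary symbol `⪯`. -/
inductive PrefixRel : ℕ → Type
  | prec : PrefixRel 2

/-- The language with function symbols `0`, `1`, `∘` and with the relation symbols `R`. -/
abbrev concatLang (R : ℕ → Type) : FirstOrder.Language.{0, 0} := ⟨ConcatFn, R⟩

/-- The language `{0, 1, ∘}`. -/
abbrev LBTminus : FirstOrder.Language.{0, 0} := concatLang fun _ => Empty

/-- The language `{0, 1, ∘, ⪯}`. -/
abbrev LBT : FirstOrder.Language.{0, 0} := concatLang PrefixRel

namespace Concat

variable {R : ℕ → Type} {β : Type}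

/-- The constant symbols `0` (for `false`) and `1` (for `true`), as terms. -/
def bit : Bool → (concatLang R).Term β
  | false => Constants.term (L := concatLang R) ConcatFn.zero
  | true => Constants.term (L := concatLang R) ConcatFn.one

/-- The term `s ∘ t`. -/
def conc (s t : (concatLang R).Term β) : (concatLang R).Term β :=
  Functions.apply₂ (L := concatLang R) ConcatFn.conc s t

/-- The biteral of a nonempty binary string: the biteral of a single letter is the constant symbol,
and the biteral of `α b` is `(biteral α) ∘ b`. (The value at the empty string is never used.) -/
def biteral : List Bool → (concatLang R).Term β
  | [] => bit false
  | a :: l => l.foldl (fun t b => conc t (bit b)) (bit a)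

/-- The set of all nonempty prefixes of `α`. -/
def Pref (α : List Bool) : Set (List Bool) := {γ | γ ≠ [] ∧ γ <+: α}

/-- The set of all nonempty substrings (contiguous subwords) of `α`. -/
def Sub (α : List Bool) : Set (List Bool) := {γ | γ ≠ [] ∧ γ <:+: α}

instance finite_Sub (α : List Bool) : Finite (Sub α) :=
  ((List.finite_toSet α.sublists).subset fun _ h => List.mem_sublists.2 h.2.sublist).to_subtype

instance finite_Pref (α : List Bool) : Finite (Pref α) :=
  ((List.finite_toSet α.sublists).subset fun _ h => List.mem_sublists.2 h.2.sublist).to_subtype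

/-- `∀ x y z [(x y) z = x (y z)]` -/
def ax1 : (concatLang R).Sentence :=
  ∀' ∀' ∀' (conc (conc (&0) (&1)) (&2) =' conc (&0) (conc (&1) (&2)))

/-- `∀ x y [x ≠ y → (x 0 ≠ y 0 ∧ x 1 ≠ y 1)]` -/
def ax2 : (concatLang R).Sentence :=
  ∀' ∀' (∼(&0 =' &1) ⟹
    (∼(conc (&0) (bit false) =' conc (&1) (bit false)) ⊓
      ∼(conc (&0) (bit true) =' conc (&1) (bit true))))

/-- `∀ x y [x 0 ≠ y 1]` -/
def ax3 : (concatLang R).Sentence :=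
  ∀' ∀' ∼(conc (&0) (bit false) =' conc (&1) (bit true))

/-- `∀ x [x ⪯ α ↔ ⋁_{γ ∈ Pref α} x = γ]`, where strings stand for their biterals -/
noncomputable def ax4 (α : List Bool) : LBT.Sentence :=
  ∀' ((Relations.boundedFormula₂ (L := LBT) PrefixRel.prec (&0) (biteral α)) ⇔
    BoundedFormula.iSup fun γ : Pref α => (&0 =' biteral γ.1))

/-- `x ⊑ α`, that is `x = α ∨ ∃ u v [α = u x ∨ α = x v ∨ α = u x v]`, where `x`, `u`, `v` are the
bound variables `&0`, `&1`, `&2` and `α` stands for its biteral -/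
def substringOf (α : List Bool) : (concatLang R).BoundedFormula Empty 1 :=
  (&0 =' biteral α) ⊔
    ∃' ∃' ((biteral α =' conc (&1) (&0)) ⊔ (biteral α =' conc (&0) (&2)) ⊔
      (biteral α =' conc (conc (&1) (&0)) (&2)))

/-- `∀ x [x ⊑ α → ⋁_{γ ∈ Sub α} x = γ]`, where strings stand for their biterals -/
noncomputable def ax4Star (α : List Bool) : (concatLang R).Sentence :=
  ∀' (substringOf α ⟹ BoundedFormula.iSup fun γ : Sub α => (&0 =' biteral γ.1))

end Concat

open Concat in
/-- The theory `ID` in the language `{0, 1, ∘, ⪯}`. -/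
def ID : LBT.Theory :=
  {ax1, ax2, ax3} ∪ {φ | ∃ α : List Bool, α ≠ [] ∧ φ = ax4 α}

open Concat in
/-- The theory `ID*` in the language `{0, 1, ∘}` extended by the relation symbols `R`, which do not
occur in its non-logical axioms. -/
def IDStar (R : ℕ → Type) : (concatLang R).Theory :=
  {ax1, ax2, ax3} ∪ {φ | ∃ α : List Bool, α ≠ [] ∧ φ = ax4Star α}

/-!
A model of `ID` or `ID*` is a semigroup with two letters in which the last letter of an element, and
what precedes it, are unique. The axiom scheme of `ID*` says that the factors of words are words,
the scheme of `ID` that `⪯` is the prefix relation on words.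

Thus `x = y ∨ ∃ v, y = x v` interprets `⪯` in `ID*`. Conversely a word in a model of `ID` may be a
product of nonstandard elements, and these are to be excluded by a formula that is stable under
multiplication. Call `x` word-like if, judging by what is `⪯ x`, it is built letter by letter. If
`x` is word-like and a final segment of a word, then removing letters from both shows that `x` is a
word. So restrict the universe to those `x` that are word-like as soon as they end below an
element `g`. For closure under multiplication only tame `g` are admitted, those below which
word-like final segments can be cancelled and multiplied. Words are tame; elements that do not end
below any tame element are kept but are not factors of words.
-/

/-! ### Inner models -/

namespace RelTranslation

variable {L₁ L₂ : FirstOrder.Language.{0, 0}}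

/-- The map `e` identifies the `L₁`-structure `N` with the structure that the translation `τ`
defines on tuples of elements of the `L₂`-structure `M`, with `τ.eq` interpreted as equality. -/
structure IsInner (τ : RelTranslation L₁ L₂) {M N : Type} [L₂.Structure M] [L₁.Structure N]
    (e : N → Fin τ.dim → M) : Prop where
  injective : Function.Injective e
  realize_dom : ∀ w : Fin τ.dim → M, τ.dom.Realize w ↔ ∃ a, e a = w
  realize_eq : ∀ a : Fin 2 → N, τ.eq.Realize (fun p => e (a p.1) p.2) ↔ a 0 = a 1
  realize_rel : ∀ {n : ℕ} (R : L₁.Relations n) (a : Fin n → N),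
    (τ.rel R).Realize (fun p => e (a p.1) p.2) ↔ Structure.RelMap R a
  realize_fn : ∀ {n : ℕ} (f : L₁.Functions n) (a : Fin n → N) (b : N),
    (τ.fn f).Realize (Sum.elim (fun p => e (a p.1) p.2) (e b)) ↔ b = Structure.funMap f a

theorem tuples_comp_splitLast {α M N : Type} {n m : ℕ} (e : N → Fin m → M) (v : α → N)
    (xs : Fin n → N) (b : N) :
    Sum.elim (fun p : (α ⊕ Fin n) × Fin m => e (Sum.elim v xs p.1) p.2) (e b) ∘ splitLast =
      fun p => e (Sum.elim v (Fin.snoc xs b) p.1) p.2 := by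
  funext p
  obtain ⟨a | k, i⟩ := p
  · rfl
  · cases k using Fin.lastCases <;>
      simp only [splitLast, Function.comp_apply, Fin.lastCases_last, Fin.lastCases_castSucc,
        Sum.elim_inl, Sum.elim_inr, Fin.snoc_last, Fin.snoc_castSucc]

namespace IsInner

variable {τ : RelTranslation L₁ L₂} {M N : Type} [L₂.Structure M] [L₁.Structure N]
  {e : N → Fin τ.dim → M}

theorem exists_eq_tuples (h : τ.IsInner e) {n : ℕ} {w : Fin n × Fin τ.dim → M}
    (hw : ∀ j, τ.dom.Realize fun i => w (j, i)) :
    ∃ a : Fin n → N, w = fun p => e (a p.1) p.2 := by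
  choose a ha using fun j => (h.realize_dom _).1 (hw j)
  exact ⟨a, funext fun p => (congrFun (ha p.1) p.2).symm⟩

theorem exists_values_iff (h : τ.IsInner e) {α : Type} {n : ℕ} {ts : Fin n → L₁.Term α}
    {v : α → N}
    (hts : ∀ j b, (τ.term (ts j)).Realize (Sum.elim (fun p => e (v p.1) p.2) (e b)) ↔
      b = (ts j).realize v)
    (P : (Fin n × Fin τ.dim → M) → Prop) :
    (∃ w : Fin n × Fin τ.dim → M, (∀ j, τ.dom.Realize fun i => w (j, i)) ∧
      (∀ j, (τ.term (ts j)).Realize (Sum.elim (fun p => e (v p.1) p.2) fun i => w (j, i))) ∧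
        P w) ↔ P fun p => e ((ts p.1).realize v) p.2 := by
  constructor
  · rintro ⟨w, hw, hval, hP⟩
    obtain ⟨a, rfl⟩ := h.exists_eq_tuples hw
    obtain rfl : a = fun j => (ts j).realize v := funext fun j => (hts j _).1 (hval j)
    exact hP
  · intro hP
    exact ⟨_, fun j => (h.realize_dom _).2 ⟨(ts j).realize v, rfl⟩, fun j => (hts j _).2 rfl, hP⟩

theorem realize_term (h : τ.IsInner e) {α : Type} (t : L₁.Term α) (v : α → N) (b : N) :
    (τ.term t).Realize (Sum.elim (fun p => e (v p.1) p.2) (e b)) ↔ b = t.realize v := by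
  induction t generalizing b with
  | var x =>
    simp only [term, Formula.realize_iInf, Formula.realize_equal, Term.realize_var, Sum.elim_inl,
      Sum.elim_inr]
    exact ⟨fun H => h.injective (funext H), fun H i => by rw [H]⟩
  | func f ts ih =>
    simp only [term, Formula.realize_iExs, Formula.realize_inf, Formula.realize_iInf,
      Formula.realize_relabel, Sum.comp_elim, and_assoc]
    exact (h.exists_values_iff ih fun w => (τ.fn f).Realize (Sum.elim w (e b))).trans
      (h.realize_fn f (fun j => (ts j).realize v) b)

theorem realize_atomic (h : τ.IsInner e) {α : Type} {n : ℕ}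
    (ψ : L₂.Formula (Fin n × Fin τ.dim)) (ts : Fin n → L₁.Term α) (v : α → N) :
    (τ.atomic ψ ts).Realize (fun p => e (v p.1) p.2) ↔
      ψ.Realize fun p => e ((ts p.1).realize v) p.2 := by
  simp only [atomic, Formula.realize_iExs, Formula.realize_inf, Formula.realize_iInf,
    Formula.realize_relabel, Sum.comp_elim, and_assoc]
  exact h.exists_values_iff (fun j => h.realize_term (ts j) v) ψ.Realize

theorem realize_formula (h : τ.IsInner e) {α : Type} {n : ℕ} (φ : L₁.BoundedFormula α n)
    (v : α → N) (xs : Fin n → N) :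
    (τ.formula φ).Realize (fun p => e (Sum.elim v xs p.1) p.2) ↔ φ.Realize v xs := by
  induction φ with
  | falsum => exact Iff.rfl
  | equal t₁ t₂ =>
    exact (h.realize_atomic τ.eq ![t₁, t₂] _).trans
      (h.realize_eq fun j => (![t₁, t₂] j).realize _)
  | rel R ts =>
    exact (h.realize_atomic (τ.rel R) ts _).trans (h.realize_rel R fun j => (ts j).realize _)
  | imp φ ψ ihφ ihψ => exact imp_congr (ihφ xs) (ihψ xs)
  | all φ ih =>
    simp only [formula, Formula.realize_iAlls, Formula.realize_imp, Formula.realize_relabel,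
      BoundedFormula.realize_all, ← ih, ← tuples_comp_splitLast]
    constructor
    · intro H b
      exact H (e b) ((h.realize_dom _).2 ⟨b, rfl⟩)
    · intro H w hw
      obtain ⟨b, rfl⟩ := (h.realize_dom w).1 hw
      exact H b

theorem realize_sentence (h : τ.IsInner e) (φ : L₁.Sentence)
    (v : (Empty ⊕ Fin 0) × Fin τ.dim → M) : (τ.formula φ).Realize v ↔ N ⊨ φ := by
  rw [Subsingleton.elim v fun p => e (Sum.elim (default : Empty → N) default p.1) p.2]
  exact h.realize_formula φ default default

end IsInner

theorem realize_equalityAxiom {L : FirstOrder.Language.{0, 0}} {N : Type} [L.Structure N]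
    {φ : L.Sentence} (h : EqualityAxiom L φ) : N ⊨ φ := by
  cases h with
  | refl => exact fun _ => rfl
  | symm => exact fun _ _ => Eq.symm
  | trans => exact fun _ _ _ => Eq.trans
  | congrFn f =>
    simp only [Sentence.Realize, Formula.realize_iAlls, Formula.realize_imp, Formula.realize_iInf,
      Formula.realize_equal, Term.realize_var, Term.realize_func, Sum.elim_inr]
    intro w hw
    exact congrArg _ (funext hw)
  | congrRel R =>
    simp only [Sentence.Realize, Formula.realize_iAlls, Formula.realize_imp, Formula.realize_iInf,
      Formula.realize_equal, Term.realize_var, Formula.realize_rel, Sum.elim_inr]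
    intro w hw H
    rwa [← funext hw]

theorem isInterpretation_of_isInner (τ : RelTranslation L₁ L₂) {S : L₁.Theory} {T : L₂.Theory}
    (H : ∀ (M : Type) [L₂.Structure M] [M ⊨ T], ∃ (N : Type) (_ : L₁.Structure N)
      (e : N → Fin τ.dim → M), Nonempty N ∧ N ⊨ S ∧ τ.IsInner e) :
    τ.IsInterpretation S T where
  dom_nonempty := by
    refine Theory.models_formula_iff.2 fun M v => ?_
    obtain ⟨N, _, e, ⟨a⟩, -, h⟩ := H M
    exact Formula.realize_iExs.2 ⟨e a, Formula.realize_relabel.2 ((h.realize_dom _).2 ⟨a, rfl⟩)⟩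
  fn_total := by
    intro n f
    refine Theory.models_formula_iff.2 fun M v => ?_
    obtain ⟨N, _, e, -, -, h⟩ := H M
    simp only [Formula.realize_imp, Formula.realize_iInf, Formula.realize_relabel,
      Formula.realize_iExsUnique, Formula.realize_inf]
    intro hv
    obtain ⟨a, rfl⟩ := h.exists_eq_tuples hv
    refine ⟨e (Structure.funMap f a),
      ⟨(h.realize_dom _).2 ⟨_, rfl⟩, (h.realize_fn f a _).2 rfl⟩, ?_⟩
    rintro w ⟨hw, hval⟩
    obtain ⟨b, rfl⟩ := (h.realize_dom w).1 hw
    exact congrArg e ((h.realize_fn f a b).1 hval)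
  eq_axioms := by
    intro φ hφ
    refine Theory.models_formula_iff.2 fun M v => ?_
    obtain ⟨N, _, e, -, -, h⟩ := H M
    exact (h.realize_sentence φ v).2 (realize_equalityAxiom hφ)
  axioms := by
    intro φ hφ
    refine Theory.models_formula_iff.2 fun M v => ?_
    obtain ⟨N, _, e, -, hS, h⟩ := H M
    exact (h.realize_sentence φ v).2 (hS.realize_of_mem φ hφ)

section Relativization

variable {F R R' : ℕ → Type}

/-- The one-dimensional translation with domain `δ` that keeps equality and the function symbols
and replaces the relation symbols by the formulas `ρ`. -/
def relativization (δ : FirstOrder.Language.Formula ⟨F, R'⟩ (Fin 1))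
    (ρ : ∀ {n : ℕ}, R n → FirstOrder.Language.Formula ⟨F, R'⟩ (Fin n × Fin 1)) :
    RelTranslation ⟨F, R⟩ ⟨F, R'⟩ where
  dim := 1
  dim_pos := Nat.one_pos
  dom := δ
  eq := Term.equal (Term.var (0, 0)) (Term.var (1, 0))
  rel := ρ
  fn f := Term.equal (Term.var (Sum.inr 0))
    (Term.func (L := ⟨F, R'⟩) f fun j => Term.var (Sum.inl (j, 0)))

theorem isInner_relativization {δ : FirstOrder.Language.Formula ⟨F, R'⟩ (Fin 1)}
    {ρ : ∀ {n : ℕ}, R n → FirstOrder.Language.Formula ⟨F, R'⟩ (Fin n × Fin 1)} {M N : Type}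
    [FirstOrder.Language.Structure ⟨F, R'⟩ M] [FirstOrder.Language.Structure ⟨F, R⟩ N]
    {i : N → M} (hi : Function.Injective i)
    (hfun : ∀ {n : ℕ} (f : F n) (a : Fin n → N),
      i (Structure.funMap (L := ⟨F, R⟩) f a) = Structure.funMap (L := ⟨F, R'⟩) f fun j => i (a j))
    (hδ : ∀ x : Fin 1 → M, δ.Realize x ↔ ∃ a, i a = x 0)
    (hρ : ∀ {n : ℕ} (r : R n) (a : Fin n → N),
      (ρ r).Realize (fun p => i (a p.1)) ↔ Structure.RelMap (L := ⟨F, R⟩) r a) :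
    (relativization δ ρ).IsInner (M := M) (N := N) fun a _ => i a where
  injective a b h := hi (congrFun h (0 : Fin 1))
  realize_dom w := (hδ w).trans <| exists_congr fun a =>
    ⟨fun h => funext fun k => h.trans (congrArg w (Subsingleton.elim (α := Fin 1) 0 k)),
      fun h => congrFun h (0 : Fin 1)⟩
  realize_eq _ := Formula.realize_equal.trans hi.eq_iff
  realize_rel := hρ
  realize_fn f a b := by
    rw [← hi.eq_iff, hfun]
    exact Formula.realize_equal

end Relativization

end RelTranslation

/-! ### Words in a semigroup -/

namespace Concat

section Semigroup

open FreeSemigroup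

variable {A M N : Type*}

@[elab_as_elim]
theorem freeSemigroup_induction_right {P : FreeSemigroup A → Prop} (of : ∀ a, P (of a))
    (mul_of : ∀ w a, P w → P (w * FreeSemigroup.of a)) (w : FreeSemigroup A) : P w := by
  obtain ⟨a, l⟩ := w
  induction l using List.reverseRecOn with
  | nil => exact of a
  | append_singleton l b ih => exact mul_of ⟨a, l⟩ b ih

/-- `x` is an initial segment of `y`, possibly the whole of it: in a semigroup, `∣` is divisibility
on the left by a proper initial segment. -/
def IsPrefix [Semigroup M] (x y : M) : Prop := x = y ∨ x ∣ y

/-- `x` is a factor of `y`, the relation `x ⊑ y` of the paper. -/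
def IsFactor [Mul M] (x y : M) : Prop :=
  x = y ∨ ∃ u v : M, (y = u * x ∨ y = x * v) ∨ y = u * x * v

/-- All factors of products in `S` lie in `S`. -/
def FactorClosed [Mul M] (S : Set M) : Prop := ∀ ⦃x y : M⦄, x * y ∈ S → x ∈ S ∧ y ∈ S

/-- The last letter of an element and what precedes it are unique, the joint content of `ID₂` and
`ID₃`. -/
def UniqueLastLetter [Mul M] (ι : A → M) : Prop :=
  Function.Injective2 fun (x : M) (a : A) => x * ι a

theorem UniqueLastLetter.of_injective [Mul M] [Mul N] {ι : A → M} {f : M →ₙ* N}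
    (hf : Function.Injective f) (h : UniqueLastLetter (f ∘ ι)) : UniqueLastLetter ι := by
  intro x y a b hxy
  have key : f x * f (ι a) = f y * f (ι b) := by simpa only [map_mul] using congrArg f hxy
  exact (h key).imp_left (@hf _ _)

/-- `e` is a right identity. Such elements are what is left of a word after all its letters have
been cancelled. -/
def IsRightId [Mul M] (e : M) : Prop := ∀ y, y * e = y

variable [Semigroup M] [Semigroup N] {ι : A → M}

theorem IsPrefix.trans {x y z : M} (hxy : IsPrefix x y) (hyz : IsPrefix y z) : IsPrefix x z := by
  obtain rfl | hxy := hxy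
  · exact hyz
  · obtain rfl | hyz := hyz
    · exact Or.inr hxy
    · exact Or.inr (hxy.trans hyz)

theorem map_lift (f : M →ₙ* N) (w : FreeSemigroup A) : f (lift ι w) = lift (f ∘ ι) w :=
  DFunLike.congr_fun (hom_ext (f := f.comp (lift ι)) (g := lift (f ∘ ι)) rfl) w

/-- The elements of `M` that are products of the letters `ι a`. For the letters `0` and `1` of a
model these are the values of the biterals. -/
def words (ι : A → M) : Subsemigroup M := (lift ι).srange

theorem lift_mem_words (w : FreeSemigroup A) : lift ι w ∈ words ι := ⟨w, rfl⟩

theorem FactorClosed.of_injective {f : M →ₙ* N} (hf : Function.Injective f)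
    (H : ∀ x y : M, f (x * y) ∈ words (f ∘ ι) → f x ∈ words (f ∘ ι) ∧ f y ∈ words (f ∘ ι)) :
    FactorClosed (words ι : Set M) := by
  have mem_iff : ∀ x, x ∈ words ι ↔ f x ∈ words (f ∘ ι) := fun x =>
    exists_congr fun w => by rw [← map_lift, hf.eq_iff]
  intro x y
  simpa only [SetLike.mem_coe, mem_iff] using H x y

/-! ### Unique readability -/

section UniqueLastLetter

variable (hι : UniqueLastLetter ι)
include hι

theorem isRightId_of_mul_letter_eq {x : M} {a b : A} (h : x * ι a = ι b) : IsRightId x := by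
  intro y
  have key : y * x * ι a = y * ι b := by rw [mul_assoc, h]
  exact (hι key).1

theorem not_isRightId_mul_letter [Nontrivial A] (x : M) (a : A) : ¬ IsRightId (x * ι a) := by
  intro h
  obtain ⟨b, hb⟩ := exists_ne a
  have key : ι b * ι b * x * ι a = ι b * ι b := by rw [mul_assoc, h]
  exact hb (hι key).2.symm

theorem not_isRightId_mul_lift [Nontrivial A] (x : M) (w : FreeSemigroup A) :
    ¬ IsRightId (x * lift ι w) := by
  cases w using freeSemigroup_induction_right with
  | of a => exact not_isRightId_mul_letter hι x a
  | mul_of w a =>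
    rw [map_mul, ← mul_assoc]
    exact not_isRightId_mul_letter hι _ a

theorem not_isRightId_lift [Nontrivial A] (w : FreeSemigroup A) : ¬ IsRightId (lift ι w) := by
  intro h
  apply not_isRightId_mul_lift hι (lift ι w) w
  rwa [h]

theorem isRightId_or_eq_mul_of_mul_letter_eq_lift {x : M} {a : A} {w : FreeSemigroup A}
    (h : x * ι a = lift ι w) : IsRightId x ∨ ∃ v, lift ι v = x ∧ v * of a = w := by
  cases w using freeSemigroup_induction_right with
  | of b => exact Or.inl (isRightId_of_mul_letter_eq hι h)
  | mul_of v b =>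
    obtain ⟨rfl, rfl⟩ := hι (h.trans (map_mul (lift ι) v (of b)))
    exact Or.inr ⟨v, rfl, rfl⟩

theorem isRightId_or_eq_mul_of_mul_lift_eq_lift [Nontrivial A] {x : M} {v w : FreeSemigroup A}
    (h : x * lift ι v = lift ι w) : IsRightId x ∨ ∃ u, lift ι u = x ∧ u * v = w := by
  induction v using freeSemigroup_induction_right generalizing w with
  | of a => exact isRightId_or_eq_mul_of_mul_letter_eq_lift hι h
  | mul_of v a ih =>
    rw [map_mul, ← mul_assoc] at h
    obtain hid | ⟨w', hw', rfl⟩ := isRightId_or_eq_mul_of_mul_letter_eq_lift hι h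
    · exact absurd hid (not_isRightId_mul_lift hι x v)
    · refine (ih hw'.symm).imp_right ?_
      rintro ⟨u, hu, rfl⟩
      exact ⟨u, hu, (mul_assoc u v (of a)).symm⟩

theorem lift_injective [Nontrivial A] : Function.Injective (lift ι) := by
  intro v w h
  induction v using freeSemigroup_induction_right generalizing w with
  | of a =>
    cases w using freeSemigroup_induction_right with
    | of b => rw [(hι (congrArg (ι a * ·) h : ι a * ι a = ι a * ι b)).2]
    | mul_of w b =>
      rw [map_mul] at h
      exact absurd (isRightId_of_mul_letter_eq hι h.symm) (not_isRightId_lift hι w)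
  | mul_of v a ih =>
    rw [map_mul] at h
    obtain hid | ⟨u, hu, rfl⟩ := isRightId_or_eq_mul_of_mul_letter_eq_lift hι h
    · exact absurd hid (not_isRightId_lift hι v)
    · rw [ih hu.symm]; rfl

end UniqueLastLetter

/-! ### Prefixes and factors of words -/

/-- On words, `le` is the prefix relation; the content of `ID₄`. -/
def IsPrefixBelowWords (le : M → M → Prop) (ι : A → M) : Prop :=
  ∀ (w : FreeSemigroup A) (x : M), le x (lift ι w) ↔ ∃ v, IsPrefix v w ∧ x = lift ι v

theorem isPrefixBelowWords_isPrefix [Nontrivial A] (hι : UniqueLastLetter ι)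
    (hwords : FactorClosed (words ι : Set M)) : IsPrefixBelowWords IsPrefix ι := by
  refine fun w x => ⟨?_, ?_⟩
  · rintro (rfl | ⟨y, hy⟩)
    · exact ⟨w, Or.inl rfl, rfl⟩
    · obtain ⟨⟨v, rfl⟩, ⟨v', rfl⟩⟩ := hwords (x := x) (y := y) ⟨w, hy⟩
      rw [← map_mul] at hy
      exact ⟨v, Or.inr ⟨v', lift_injective hι hy⟩, rfl⟩
  · rintro ⟨v, hv, rfl⟩
    exact hv.imp (congrArg _) (map_dvd (lift ι))

theorem exists_isFactor_of_isFactor_lift [Nontrivial A] (hι : UniqueLastLetter ι)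
    (hwords : FactorClosed (words ι : Set M)) {w : FreeSemigroup A} {x : M}
    (hx : IsFactor x (lift ι w)) : ∃ v, IsFactor v w ∧ x = lift ι v := by
  have hinj := lift_injective hι
  obtain rfl | ⟨u, v, (h | h) | h⟩ := hx
  · exact ⟨w, Or.inl rfl, rfl⟩
  · obtain ⟨⟨a, rfl⟩, ⟨b, rfl⟩⟩ := hwords (x := u) (y := x) ⟨w, h⟩
    exact ⟨b, Or.inr ⟨a, a, Or.inl (Or.inl (hinj (by rw [h, map_mul])))⟩, rfl⟩
  · obtain ⟨⟨a, rfl⟩, ⟨b, rfl⟩⟩ := hwords (x := x) (y := v) ⟨w, h⟩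
    exact ⟨a, Or.inr ⟨b, b, Or.inl (Or.inr (hinj (by rw [h, map_mul])))⟩, rfl⟩
  · obtain ⟨hux, ⟨c, rfl⟩⟩ := hwords (x := u * x) (y := v) ⟨w, h⟩
    obtain ⟨⟨a, rfl⟩, ⟨b, rfl⟩⟩ := hwords hux
    exact ⟨b, Or.inr ⟨a, c, Or.inr (hinj (by rw [h, map_mul, map_mul]))⟩, rfl⟩

theorem factorClosed_words_iff [Nontrivial A] (hι : UniqueLastLetter ι) :
    FactorClosed (words ι : Set M) ↔
      ∀ (w : FreeSemigroup A) (x : M), IsFactor x (lift ι w) →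
        ∃ v, IsFactor v w ∧ x = lift ι v := by
  refine ⟨fun hwords _ _ => exists_isFactor_of_isFactor_lift hι hwords, fun H x y => ?_⟩
  rintro ⟨w, hw⟩
  obtain ⟨u, -, rfl⟩ := H w x (Or.inr ⟨x, y, Or.inl (Or.inr hw)⟩)
  obtain ⟨v, -, rfl⟩ := H w y (Or.inr ⟨lift ι u, y, Or.inl (Or.inl hw)⟩)
  exact ⟨lift_mem_words u, lift_mem_words v⟩

end Semigroup

/-! ### The domain of the interpretation of `ID*` in `ID` -/

section Domain

open FreeSemigroup

variable {A M : Type*}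

/-- `x` is a final segment of some element `⪯ g`. -/
def EndsBelow [Mul M] (le : M → M → Prop) (g x : M) : Prop := ∃ u, le (u * x) g

/-- As far as `le` can tell, `x` is a word: everything below `x`, including `x` itself, is a letter
or arises from something below `x` by appending a letter. -/
def IsWordLike [Mul M] (le : M → M → Prop) (ι : A → M) (x : M) : Prop :=
  le x x ∧ ∀ y, le y x → (∃ a, y = ι a) ∨ ∃ z a, le z x ∧ y = z * ι a

/-- Word-like final segments of elements below `g` can be cancelled, and products of word-like
elements that end below `g` are word-like. All words are tame. -/
def IsTame [Mul M] (le : M → M → Prop) (ι : A → M) (g : M) : Prop :=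
  ∀ x y, IsWordLike le ι y → EndsBelow le g (x * y) →
    EndsBelow le g x ∧ (IsWordLike le ι x → IsWordLike le ι (x * y))

variable [Semigroup M] {ι : A → M}

/-- The domain of the interpretation of `ID*` in `ID`: all `x` that are word-like as soon as they
end below some tame element. -/
def domain (le : M → M → Prop) (ι : A → M) : Subsemigroup M where
  carrier := {x | ∀ g, IsTame le ι g → EndsBelow le g x → IsWordLike le ι x}
  mul_mem' := by
    rintro x y hx hy g hg ⟨u, hu⟩
    have hy' : IsWordLike le ι y := hy g hg ⟨u * x, by rwa [mul_assoc]⟩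
    obtain ⟨hgx, hxy⟩ := hg x y hy' ⟨u, hu⟩
    exact hxy (hx g hg hgx)

variable {le : M → M → Prop}

theorem mem_domain_iff {x : M} :
    x ∈ domain le ι ↔ ∀ g, IsTame le ι g → EndsBelow le g x → IsWordLike le ι x := Iff.rfl

theorem IsPrefixBelowWords.le_lift (hle : IsPrefixBelowWords le ι) {v w : FreeSemigroup A}
    (h : IsPrefix v w) : le (lift ι v) (lift ι w) :=
  (hle w _).2 ⟨v, h, rfl⟩

theorem IsPrefixBelowWords.isWordLike_lift (hle : IsPrefixBelowWords le ι) (w : FreeSemigroup A) :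
    IsWordLike le ι (lift ι w) := by
  refine ⟨hle.le_lift (Or.inl rfl), fun y hy => ?_⟩
  obtain ⟨v, hvw, rfl⟩ := (hle w y).1 hy
  cases v using freeSemigroup_induction_right with
  | of a => exact Or.inl ⟨a, rfl⟩
  | mul_of v a =>
    exact Or.inr ⟨lift ι v, a, hle.le_lift (IsPrefix.trans (Or.inr ⟨of a, rfl⟩) hvw), map_mul ..⟩

theorem IsPrefixBelowWords.lift_mem_domain (hle : IsPrefixBelowWords le ι) (w : FreeSemigroup A) :
    lift ι w ∈ domain le ι :=
  fun _ _ _ => hle.isWordLike_lift w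

variable [Nontrivial A] (hι : UniqueLastLetter ι)
include hι

theorem IsWordLike.not_isRightId_mul {x y : M} (hx : IsWordLike le ι x) (hy : le y x) (u : M) :
    ¬ IsRightId (u * y) := by
  obtain ⟨a, rfl⟩ | ⟨z, a, -, rfl⟩ := hx.2 y hy
  · exact not_isRightId_mul_letter hι u a
  · rw [← mul_assoc]
    exact not_isRightId_mul_letter hι _ a

theorem IsWordLike.mem_words_of_mul_eq_lift {x y u : M} (hx : IsWordLike le ι x) (hy : le y x)
    {w : FreeSemigroup A} (h : u * y = lift ι w) : y ∈ words ι := by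
  induction w using freeSemigroup_induction_right generalizing y with
  | of b =>
    obtain ⟨a, rfl⟩ | ⟨z, a, hz, rfl⟩ := hx.2 y hy
    · exact lift_mem_words (of a)
    · rw [← mul_assoc] at h
      exact absurd (isRightId_of_mul_letter_eq hι h) (hx.not_isRightId_mul hι hz u)
  | mul_of w b ih =>
    obtain ⟨a, rfl⟩ | ⟨z, a, hz, rfl⟩ := hx.2 y hy
    · exact lift_mem_words (of a)
    · rw [← mul_assoc, map_mul] at h
      exact mul_mem (ih hz (hι h).1) (lift_mem_words (of a))

theorem IsWordLike.mem_words_of_endsBelow (hle : IsPrefixBelowWords le ι) {x : M}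
    (hx : IsWordLike le ι x) {w : FreeSemigroup A} (h : EndsBelow le (lift ι w) x) :
    x ∈ words ι := by
  obtain ⟨u, hu⟩ := h
  obtain ⟨v, -, hv⟩ := (hle w _).1 hu
  exact hx.mem_words_of_mul_eq_lift hι hx.1 hv

theorem IsPrefixBelowWords.endsBelow_of_mul_lift (hle : IsPrefixBelowWords le ι) {x : M}
    {v w : FreeSemigroup A} (h : EndsBelow le (lift ι w) (x * lift ι v)) :
    EndsBelow le (lift ι w) x := by
  obtain ⟨u, hu⟩ := h
  obtain ⟨w', hw', huw⟩ := (hle w _).1 hu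
  rw [← mul_assoc] at huw
  obtain hid | ⟨v', hv', rfl⟩ := isRightId_or_eq_mul_of_mul_lift_eq_lift hι huw
  · -- All letters of `lift ι w` are cancelled, so `u * x` acts on it as the empty word.
    refine ⟨lift ι w * u, ?_⟩
    rw [mul_assoc, hid]
    exact hle.le_lift (Or.inl rfl)
  · refine ⟨u, ?_⟩
    rw [← hv']
    exact hle.le_lift (IsPrefix.trans (Or.inr ⟨v, rfl⟩) hw')

theorem IsPrefixBelowWords.isTame_lift (hle : IsPrefixBelowWords le ι) (w : FreeSemigroup A) :
    IsTame le ι (lift ι w) := by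
  rintro x y hy hxy
  have hy' : y ∈ words ι := by
    obtain ⟨u, hu⟩ := hxy
    exact hy.mem_words_of_endsBelow hι hle ⟨u * x, by rwa [mul_assoc]⟩
  obtain ⟨v, rfl⟩ := hy'
  have hx : EndsBelow le (lift ι w) x := hle.endsBelow_of_mul_lift hι hxy
  refine ⟨hx, fun hx' => ?_⟩
  obtain ⟨u, rfl⟩ := hx'.mem_words_of_endsBelow hι hle hx
  rw [← map_mul]
  exact hle.isWordLike_lift (u * v)

theorem IsPrefixBelowWords.mem_words_of_mul_mem_words (hle : IsPrefixBelowWords le ι) {x y : M}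
    (hx : x ∈ domain le ι) (hy : y ∈ domain le ι) (hxy : x * y ∈ words ι) :
    x ∈ words ι ∧ y ∈ words ι := by
  obtain ⟨w, hw⟩ := hxy
  obtain ⟨a⟩ : Nonempty A := inferInstance
  -- There is no empty word to put in front of `x`, hence the additional letter `a`.
  have htame : IsTame le ι (lift ι (of a * w)) := hle.isTame_lift hι _
  have hself : le (ι a * (x * y)) (lift ι (of a * w)) := by
    rw [← hw, ← lift_of ι a, ← map_mul]
    exact hle.le_lift (Or.inl rfl)
  have hy' : IsWordLike le ι y := hy _ htame ⟨ι a * x, by rwa [mul_assoc]⟩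
  have hgx : EndsBelow le (lift ι (of a * w)) x := (htame x y hy' ⟨ι a, hself⟩).1
  have hx' : IsWordLike le ι x := hx _ htame hgx
  exact ⟨hx'.mem_words_of_endsBelow hι hle hgx, hy'.mem_words_of_mul_eq_lift hι hy'.1 hw.symm⟩

end Domain

/-! ### Nonempty strings as elements of the free semigroup -/

section Strings

variable {A : Type*}

/-- The nonempty string of letters of `w`. -/
def toList (w : FreeSemigroup A) : List A := w.head :: w.tail

theorem toList_injective : Function.Injective (toList (A := A)) := fun _ _ h =>
  FreeSemigroup.ext (List.cons.inj h).1 (List.cons.inj h).2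

theorem exists_toList_eq {l : List A} (hl : l ≠ []) : ∃ w, toList w = l :=
  ⟨⟨l.head hl, l.tail⟩, List.cons_head_tail hl⟩

theorem toList_prefix_toList {v w : FreeSemigroup A} :
    toList v <+: toList w ↔ IsPrefix v w := by
  constructor
  · rintro ⟨t, ht⟩
    obtain rfl | hne := eq_or_ne t []
    · exact Or.inl (toList_injective (by rwa [List.append_nil] at ht))
    · obtain ⟨u, rfl⟩ := exists_toList_eq hne
      exact Or.inr ⟨u, toList_injective ht.symm⟩
  · rintro (rfl | ⟨u, rfl⟩)
    · exact List.prefix_rfl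
    · exact List.prefix_append _ _

theorem toList_infix_toList {v w : FreeSemigroup A} :
    toList v <:+: toList w ↔ IsFactor v w := by
  constructor
  · rintro ⟨s, t, hst⟩
    obtain rfl | hs := eq_or_ne s [] <;> obtain rfl | ht := eq_or_ne t []
    · exact Or.inl (toList_injective (by simpa only [List.nil_append, List.append_nil] using hst))
    · obtain ⟨u, rfl⟩ := exists_toList_eq ht
      exact Or.inr ⟨u, u, Or.inl (Or.inr (toList_injective hst.symm))⟩
    · obtain ⟨u, rfl⟩ := exists_toList_eq hs
      rw [List.append_nil] at hst
      exact Or.inr ⟨u, u, Or.inl (Or.inl (toList_injective hst.symm))⟩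
    · obtain ⟨u, rfl⟩ := exists_toList_eq hs
      obtain ⟨u', rfl⟩ := exists_toList_eq ht
      exact Or.inr ⟨u, u', Or.inr (toList_injective hst.symm)⟩
  · rintro (rfl | ⟨u, u', (rfl | rfl) | rfl⟩)
    · exact List.infix_rfl
    · exact (List.suffix_append (toList u) (toList v)).isInfix
    · exact (List.prefix_append (toList v) (toList u')).isInfix
    · exact List.infix_append (toList u) (toList v) (toList u')

theorem mem_Pref_toList {l : List Bool} {w : FreeSemigroup Bool} :
    l ∈ Pref (toList w) ↔ ∃ v, IsPrefix v w ∧ toList v = l := by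
  constructor
  · rintro ⟨hl, hlw⟩
    obtain ⟨v, rfl⟩ := exists_toList_eq hl
    exact ⟨v, toList_prefix_toList.1 hlw, rfl⟩
  · rintro ⟨v, hv, rfl⟩
    exact ⟨List.cons_ne_nil _ _, toList_prefix_toList.2 hv⟩

theorem mem_Sub_toList {l : List Bool} {w : FreeSemigroup Bool} :
    l ∈ Sub (toList w) ↔ ∃ v, IsFactor v w ∧ toList v = l := by
  constructor
  · rintro ⟨hl, hlw⟩
    obtain ⟨v, rfl⟩ := exists_toList_eq hl
    exact ⟨v, toList_infix_toList.1 hlw, rfl⟩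
  · rintro ⟨v, hv, rfl⟩
    exact ⟨List.cons_ne_nil _ _, toList_infix_toList.2 hv⟩

end Strings

/-! ### Models -/

open FreeSemigroup (lift)

variable {R : ℕ → Type} {M : Type}

/-- The symbols `∘`, `0` and `1` of the structure `M` denote the multiplication of `M` and the
letters `ι false` and `ι true`. -/
structure IsCompatible (R : ℕ → Type) (M : Type) [(concatLang R).Structure M] [Mul M]
    (ι : Bool → M) : Prop where
  funMap_zero : ∀ a, Structure.funMap (L := concatLang R) ConcatFn.zero a = ι false
  funMap_one : ∀ a, Structure.funMap (L := concatLang R) ConcatFn.one a = ι true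
  funMap_conc : ∀ a : Fin 2 → M, Structure.funMap (L := concatLang R) ConcatFn.conc a = a 0 * a 1

/-- The interpretation of `⪯` in `M`. -/
def Prec (M : Type) [LBT.Structure M] (x y : M) : Prop :=
  Structure.RelMap (L := LBT) PrefixRel.prec ![x, y]

namespace IsCompatible

section Mul

variable [(concatLang R).Structure M] [Mul M] {ι : Bool → M} (h : IsCompatible R M ι) {β : Type}
include h

theorem realize_bit (c : Bool) (v : β → M) :
    (bit c : (concatLang R).Term β).realize v = ι c := by
  cases c
  · exact h.funMap_zero _
  · exact h.funMap_one _

theorem realize_conc (s t : (concatLang R).Term β) (v : β → M) :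
    (conc s t).realize v = s.realize v * t.realize v :=
  h.funMap_conc _

theorem realize_ax1 : M ⊨ (ax1 : (concatLang R).Sentence) ↔
    ∀ x y z : M, x * y * z = x * (y * z) := by
  simp only [ax1, Sentence.Realize, Formula.Realize, BoundedFormula.realize_all,
    BoundedFormula.realize_bdEqual, h.realize_conc]
  exact Iff.rfl

theorem realize_ax2 : M ⊨ (ax2 : (concatLang R).Sentence) ↔
    ∀ (x y : M) (c : Bool), x * ι c = y * ι c → x = y := by
  simp only [ax2, Sentence.Realize, Formula.Realize, BoundedFormula.realize_all,
    BoundedFormula.realize_imp, BoundedFormula.realize_inf, BoundedFormula.realize_not,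
    BoundedFormula.realize_bdEqual, h.realize_conc, h.realize_bit, Bool.forall_bool,
    ← not_or, not_imp_not, or_imp]
  exact Iff.rfl

theorem realize_ax3 : M ⊨ (ax3 : (concatLang R).Sentence) ↔
    ∀ x y : M, x * ι false ≠ y * ι true := by
  simp only [ax3, Sentence.Realize, Formula.Realize, BoundedFormula.realize_all,
    BoundedFormula.realize_not, BoundedFormula.realize_bdEqual, h.realize_conc, h.realize_bit]
  exact Iff.rfl

theorem uniqueLastLetter_iff : UniqueLastLetter ι ↔
    M ⊨ (ax2 : (concatLang R).Sentence) ∧ M ⊨ (ax3 : (concatLang R).Sentence) := by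
  rw [h.realize_ax2, h.realize_ax3]
  constructor
  · intro hι
    exact ⟨fun x y c hxy => (hι hxy).1, fun x y hxy => Bool.false_ne_true (hι hxy).2⟩
  · rintro ⟨hcancel, hne⟩ x y (_ | _) (_ | _) hxy
    · exact ⟨hcancel x y _ hxy, rfl⟩
    · exact absurd hxy (hne x y)
    · exact absurd hxy.symm (hne y x)
    · exact ⟨hcancel x y _ hxy, rfl⟩

theorem map_funMap {R' : ℕ → Type} {N : Type} [(concatLang R').Structure N] [Mul N] {κ : Bool → N}
    (hN : IsCompatible R' N κ) {i : N →ₙ* M} (hi : ∀ c, i (κ c) = ι c) {n : ℕ} (f : ConcatFn n)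
    (a : Fin n → N) :
    i (Structure.funMap (L := concatLang R') f a) =
      Structure.funMap (L := concatLang R) f fun j => i (a j) := by
  cases f with
  | zero => rw [hN.funMap_zero, h.funMap_zero, hi]
  | one => rw [hN.funMap_one, h.funMap_one, hi]
  | conc => rw [hN.funMap_conc, h.funMap_conc, map_mul]

end Mul

theorem exists_of_realize_ax1 [(concatLang R).Structure M]
    (h : M ⊨ (ax1 : (concatLang R).Sentence)) :
    ∃ (_ : Semigroup M) (ι : Bool → M), IsCompatible R M ι := by
  let mul : Mul M := ⟨fun x y => Structure.funMap (L := concatLang R) ConcatFn.conc ![x, y]⟩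
  let ι (c : Bool) : M := (bit c : (concatLang R).Term Empty).realize default
  have hM : IsCompatible R M ι :=
    ⟨fun a => congrArg _ (Subsingleton.elim a _), fun a => congrArg _ (Subsingleton.elim a _),
      fun a => congrArg _ (List.ofFn_injective rfl)⟩
  exact ⟨{ mul with mul_assoc := hM.realize_ax1.1 h }, ι, hM⟩

section Semigroup

variable [Semigroup M] {ι : Bool → M}

section

variable [(concatLang R).Structure M] (h : IsCompatible R M ι)
include h

theorem realize_biteral {β : Type} (w : FreeSemigroup Bool) (v : β → M) :
    (biteral (toList w) : (concatLang R).Term β).realize v = lift ι w := by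
  induction w using freeSemigroup_induction_right with
  | of a => exact h.realize_bit a v
  | mul_of w a ih =>
    rw [map_mul, ← ih, FreeSemigroup.lift_of, ← h.realize_bit a v, ← h.realize_conc]
    exact congrArg _ (List.foldl_append ..)

theorem realize_ax4Star (w : FreeSemigroup Bool) :
    M ⊨ (ax4Star (toList w) : (concatLang R).Sentence) ↔
      ∀ x, IsFactor x (lift ι w) → ∃ v, IsFactor v w ∧ x = lift ι v := by
  simp only [ax4Star, substringOf, Sentence.Realize, Formula.Realize, BoundedFormula.realize_all,
    BoundedFormula.realize_imp, BoundedFormula.realize_sup, BoundedFormula.realize_ex,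
    BoundedFormula.realize_iSup, BoundedFormula.realize_bdEqual, h.realize_conc,
    Subtype.exists, exists_prop, mem_Sub_toList, exists_exists_and_eq_and, h.realize_biteral]
  exact Iff.rfl

theorem model_IDStar_iff :
    M ⊨ IDStar R ↔ UniqueLastLetter ι ∧ FactorClosed (words ι : Set M) := by
  rw [and_congr_right factorClosed_words_iff, h.uniqueLastLetter_iff, Theory.model_iff]
  simp only [← h.realize_ax4Star]
  constructor
  · intro H
    exact ⟨⟨H _ (by simp [IDStar]), H _ (by simp [IDStar])⟩,
      fun w => H _ (Or.inr ⟨toList w, List.cons_ne_nil _ _, rfl⟩)⟩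
  · rintro ⟨⟨h₂, h₃⟩, h₄⟩ φ ((rfl | rfl | rfl) | ⟨l, hl, rfl⟩)
    · exact h.realize_ax1.2 mul_assoc
    · exact h₂
    · exact h₃
    · obtain ⟨w, rfl⟩ := exists_toList_eq hl
      exact h₄ w

end

section

variable [LBT.Structure M] (h : IsCompatible PrefixRel M ι)
include h

theorem realize_ax4 (w : FreeSemigroup Bool) :
    M ⊨ ax4 (toList w) ↔ ∀ x, Prec M x (lift ι w) ↔ ∃ v, IsPrefix v w ∧ x = lift ι v := by
  simp only [ax4, Sentence.Realize, Formula.Realize, BoundedFormula.realize_all,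
    BoundedFormula.realize_iff, BoundedFormula.realize_rel₂,
    BoundedFormula.realize_iSup, BoundedFormula.realize_bdEqual,
    Subtype.exists, exists_prop, mem_Pref_toList, exists_exists_and_eq_and, h.realize_biteral]
  exact Iff.rfl

theorem model_ID_iff :
    M ⊨ ID ↔ UniqueLastLetter ι ∧ IsPrefixBelowWords (Prec M) ι := by
  rw [h.uniqueLastLetter_iff, Theory.model_iff]
  simp only [IsPrefixBelowWords, ← h.realize_ax4]
  constructor
  · intro H
    exact ⟨⟨H _ (by simp [ID]), H _ (by simp [ID])⟩,
      fun w => H _ (Or.inr ⟨toList w, List.cons_ne_nil _ _, rfl⟩)⟩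
  · rintro ⟨⟨h₂, h₃⟩, h₄⟩ φ ((rfl | rfl | rfl) | ⟨l, hl, rfl⟩)
    · exact h.realize_ax1.2 mul_assoc
    · exact h₂
    · exact h₃
    · obtain ⟨w, rfl⟩ := exists_toList_eq hl
      exact h₄ w

end

end Semigroup
end IsCompatible

/-- The structure on `M` with `∘`, `0` and `1` as in `IsCompatible` and with the relations `rel`. -/
abbrev toStructure [Mul M] (ι : Bool → M) (rel : ∀ {n : ℕ}, R n → (Fin n → M) → Prop) :
    (concatLang R).Structure M where
  funMap f a := match f, a with
    | .zero, _ => ι false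
    | .one, _ => ι true
    | .conc, a => a 0 * a 1
  RelMap := rel

theorem isCompatible_toStructure [Mul M] (ι : Bool → M)
    (rel : ∀ {n : ℕ}, R n → (Fin n → M) → Prop) :
    letI := toStructure ι rel
    IsCompatible R M ι :=
  letI := toStructure ι rel
  ⟨fun _ => rfl, fun _ => rfl, fun _ => rfl⟩

/-! ### The domain formula -/

section Formulas

section Terms

variable {L : FirstOrder.Language.{0, 0}} {α M : Type} {n : ℕ}

/-- The term `t` under one more quantifier. -/
def shift (t : L.Term (α ⊕ Fin n)) : L.Term (α ⊕ Fin (n + 1)) :=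
  t.relabel (Sum.map id Fin.castSucc)

/-- The variable bound by the innermost quantifier. -/
def newest : L.Term (α ⊕ Fin (n + 1)) := &(Fin.last n)

variable [L.Structure M] (v : α → M) (xs : Fin n → M) (a : M)

theorem realize_shift (t : L.Term (α ⊕ Fin n)) :
    (shift t).realize (Sum.elim v (Fin.snoc xs a : Fin (n + 1) → M)) =
      t.realize (Sum.elim v xs) := by
  rw [shift, Term.realize_relabel, Sum.elim_comp_map, Function.comp_id, Fin.snoc_comp_castSucc]

theorem realize_newest :
    (newest : L.Term (α ⊕ Fin (n + 1))).realize (Sum.elim v (Fin.snoc xs a : Fin (n + 1) → M)) =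
      a := by
  simp only [newest, Function.comp_apply, Term.realize_var, Sum.elim_inr, Fin.snoc_last]

end Terms

variable {α M : Type} {n : ℕ}

/-- The atomic formula `s ⪯ t`. -/
def prec (s t : LBT.Term (α ⊕ Fin n)) : LBT.BoundedFormula α n :=
  Relations.boundedFormula₂ (L := LBT) PrefixRel.prec s t

/-- The formula that defines `EndsBelow`. -/
def endsBelowFormula (g x : LBT.Term (α ⊕ Fin n)) : LBT.BoundedFormula α n :=
  ∃' prec (conc newest (shift x)) (shift g)

/-- The formula that defines `IsWordLike`. -/
noncomputable def isWordLikeFormula (x : LBT.Term (α ⊕ Fin n)) : LBT.BoundedFormula α n :=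
  prec x x ⊓ ∀' (prec newest (shift x) ⟹
    (BoundedFormula.iSup fun a : Bool => newest =' bit a) ⊔
      ∃' BoundedFormula.iSup fun a : Bool =>
        prec newest (shift (shift x)) ⊓ (shift newest =' conc newest (bit a)))

/-- The formula that defines `IsTame`. -/
noncomputable def isTameFormula (g : LBT.Term (α ⊕ Fin n)) : LBT.BoundedFormula α n :=
  ∀' ∀' (isWordLikeFormula newest ⟹
    endsBelowFormula (shift (shift g)) (conc (shift newest) newest) ⟹
      endsBelowFormula (shift (shift g)) (shift newest) ⊓
        (isWordLikeFormula (shift newest) ⟹ isWordLikeFormula (conc (shift newest) newest)))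

/-- The formula that defines `domain`. -/
noncomputable def domainFormula (x : LBT.Term (α ⊕ Fin n)) : LBT.BoundedFormula α n :=
  ∀' (isTameFormula newest ⟹ endsBelowFormula newest (shift x) ⟹ isWordLikeFormula (shift x))

variable [LBT.Structure M] {v : α → M} {xs : Fin n → M}

theorem realize_prec {s t : LBT.Term (α ⊕ Fin n)} :
    (prec s t).Realize v xs ↔ Prec M (s.realize (Sum.elim v xs)) (t.realize (Sum.elim v xs)) :=
  BoundedFormula.realize_rel₂

namespace IsCompatible

variable [Semigroup M] {ι : Bool → M} (h : IsCompatible PrefixRel M ι)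
include h

theorem realize_endsBelowFormula {g x : LBT.Term (α ⊕ Fin n)} :
    (endsBelowFormula g x).Realize v xs ↔
      EndsBelow (Prec M) (g.realize (Sum.elim v xs)) (x.realize (Sum.elim v xs)) := by
  simp only [endsBelowFormula, EndsBelow, BoundedFormula.realize_ex, realize_prec, h.realize_conc,
    realize_newest, realize_shift]

theorem realize_isWordLikeFormula {x : LBT.Term (α ⊕ Fin n)} :
    (isWordLikeFormula x).Realize v xs ↔
      IsWordLike (Prec M) ι (x.realize (Sum.elim v xs)) := by
  simp only [isWordLikeFormula, IsWordLike, BoundedFormula.realize_inf, BoundedFormula.realize_all,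
    BoundedFormula.realize_imp, BoundedFormula.realize_sup, BoundedFormula.realize_ex,
    BoundedFormula.realize_iSup, BoundedFormula.realize_bdEqual, realize_prec, h.realize_conc,
    h.realize_bit, realize_newest, realize_shift]

theorem realize_isTameFormula {g : LBT.Term (α ⊕ Fin n)} :
    (isTameFormula g).Realize v xs ↔ IsTame (Prec M) ι (g.realize (Sum.elim v xs)) := by
  simp only [isTameFormula, IsTame, BoundedFormula.realize_inf, BoundedFormula.realize_all,
    BoundedFormula.realize_imp, h.realize_endsBelowFormula, h.realize_isWordLikeFormula,
    h.realize_conc, realize_newest, realize_shift]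

theorem realize_domainFormula {x : LBT.Term (α ⊕ Fin n)} :
    (domainFormula x).Realize v xs ↔ x.realize (Sum.elim v xs) ∈ domain (Prec M) ι := by
  simp only [domainFormula, mem_domain_iff, BoundedFormula.realize_all,
    BoundedFormula.realize_imp, h.realize_isTameFormula, h.realize_endsBelowFormula,
    h.realize_isWordLikeFormula, realize_newest, realize_shift]

end IsCompatible
end Formulas

/-! ### The interpretations -/

open RelTranslation (relativization isInner_relativization isInterpretation_of_isInner)

/-- The formula `s = t ∨ ∃ y [t = s y]`, that defines `IsPrefix`. -/
def isPrefixFormula {R : ℕ → Type} {α : Type} {n : ℕ} (s t : (concatLang R).Term (α ⊕ Fin n)) :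
    (concatLang R).BoundedFormula α n :=
  (s =' t) ⊔ ∃' (shift t =' conc (shift s) newest)

theorem IsCompatible.realize_isPrefixFormula {R : ℕ → Type} {α M : Type} {n : ℕ}
    [(concatLang R).Structure M] [Semigroup M] {ι : Bool → M} (h : IsCompatible R M ι)
    {s t : (concatLang R).Term (α ⊕ Fin n)} {v : α → M} {xs : Fin n → M} :
    (isPrefixFormula s t).Realize v xs ↔
      IsPrefix (s.realize (Sum.elim v xs)) (t.realize (Sum.elim v xs)) := by
  simp only [isPrefixFormula, IsPrefix, BoundedFormula.realize_sup, BoundedFormula.realize_ex,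
    BoundedFormula.realize_bdEqual, h.realize_conc, realize_newest, realize_shift]
  exact Iff.rfl

variable (R : ℕ → Type)

theorem interpretable_ID_IDStar : Interpretable ID (IDStar R) := by
  let ρ {n : ℕ} (r : PrefixRel n) : (concatLang R).Formula (Fin n × Fin 1) := match r with
    | .prec => isPrefixFormula (Term.var (Sum.inl (0, 0))) (Term.var (Sum.inl (1, 0)))
  refine ⟨relativization ⊤ ρ, isInterpretation_of_isInner _ fun M _ hM => ?_⟩
  obtain ⟨_, ι, h⟩ :=
    IsCompatible.exists_of_realize_ax1 (hM.realize_of_mem ax1 (Or.inl (Or.inl rfl)))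
  obtain ⟨hι, hwords⟩ := h.model_IDStar_iff.1 hM
  let rel {n : ℕ} (r : PrefixRel n) (a : Fin n → M) : Prop := match r, a with
    | .prec, a => IsPrefix (a 0) (a 1)
  let S := toStructure ι rel
  have hS : IsCompatible PrefixRel M ι := isCompatible_toStructure ι rel
  refine ⟨M, S, fun x _ => x, ⟨ι true⟩,
    hS.model_ID_iff.2 ⟨hι, isPrefixBelowWords_isPrefix hι hwords⟩,
    isInner_relativization (i := id) Function.injective_id ?_ ?_ ?_⟩
  · exact h.map_funMap hS (i := MulHom.id M) fun _ => rfl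
  · exact fun x => ⟨fun _ => ⟨x 0, rfl⟩, fun _ => BoundedFormula.realize_top.2 trivial⟩
  · rintro n ⟨⟩ a
    exact h.realize_isPrefixFormula

theorem interpretable_IDStar_ID : Interpretable (IDStar R) ID := by
  let δ : LBT.Formula (Fin 1) := domainFormula (Term.var (Sum.inl 0))
  refine ⟨relativization δ fun _ => ⊥, isInterpretation_of_isInner _ fun M _ hM => ?_⟩
  obtain ⟨_, ι, h⟩ :=
    IsCompatible.exists_of_realize_ax1 (hM.realize_of_mem ax1 (Or.inl (Or.inl rfl)))
  obtain ⟨hι, hle⟩ := h.model_ID_iff.1 hM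
  let D := domain (Prec M) ι
  let κ (c : Bool) : D := ⟨ι c, hle.lift_mem_domain (FreeSemigroup.of c)⟩
  have hinj : Function.Injective (MulMemClass.subtype D) := Subtype.val_injective
  let S : (concatLang R).Structure D := toStructure κ fun _ _ => False
  have hS : IsCompatible R D κ := isCompatible_toStructure κ _
  refine ⟨D, S, fun x _ => x, ⟨κ true⟩, hS.model_IDStar_iff.2 ⟨.of_injective hinj hι,
    .of_injective hinj fun x y => hle.mem_words_of_mul_mem_words hι x.2 y.2⟩,
    isInner_relativization hinj ?_ ?_ ?_⟩
  · exact h.map_funMap hS (i := MulMemClass.subtype D) fun _ => rfl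
  · exact fun x => h.realize_domainFormula.trans
      ⟨fun hx => ⟨⟨x 0, hx⟩, rfl⟩, fun ⟨a, (ha : a.1 = x 0)⟩ => (ha ▸ a.2 : x 0 ∈ D)⟩
  · exact fun _ _ => Iff.rfl

end Concat

theorem mainTheorem2_general (R : ℕ → Type) : MutuallyInterpretable ID (IDStar R) :=
  ⟨Concat.interpretable_ID_IDStar R, Concat.interpretable_IDStar_ID R⟩

/-- `ID` and `ID*` are mutually interpretable, whether the language of `ID*` is taken to be
`{0, 1, ∘}` or the language `{0, 1, ∘, ⪯}` of `ID`. -/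
theorem mainTheorem2 :
    MutuallyInterpretable ID (IDStar fun _ => Empty) ∧
      MutuallyInterpretable ID (IDStar PrefixRel) :=
  ⟨mainTheorem2_general _, mainTheorem2_general _⟩
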